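/- Let $X$ and $Y$ be discrete random variables on a probability space $(\Omega,\mathcal A,\mathbb P)$ with values in finite sets $\{x_1,\dots,x_r\}$ and $\{y_1,\dots,y_s\}$ (distinct elements). Put $p_{i,j}=\mathbb P(X=x_i,Y=y_j)$, $p_{X,i}=\mathbb P(X=x_i)$, $p_{Y,j}=\mathbb P(Y=y_j)$ and $\delta_i^j=s(i-1)+j$. Let $Z$ be a random variable with values in a set $\{z_1,\dots,z_{rs}\}$ of $rs$ distinct elements such that $\mathbb P(Z=z_{\delta_i^j})=p_{i,j}$ for all $i,j$, and suppose that $\mathbb P(Z=z_k)>0$ for every $k\in\{1,\dots,rs\}$. Let $Z_1,Z_2,\dots$ be independent copies of $Z$, and for $n\ge 1$ put $$\widehat p_{i,j}^{(n)}=\frac1n\sum_{\ell=1}^n 1_{\{Z_\ell=z_{\delta_i^j}\}},\qquad \widehat p_{X,i}^{(n)}=\sum_{j=1}^s\widehat p_{i,j}^{(n)},\qquad \widehat p_{Y,j}^{(n)}=\sum_{i=1}^r\widehat p_{i,j}^{(n)}.$$ Let $$\mathcal E=\sum_{i,j}p_{i,j}\log\frac{p_{i,j}}{p_{X,i}\,p_{Y,j}},\qquad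 \widehat{\mathcal E}_n=\sum_{i,j}\widehat p_{i,j}^{(n)}\log\frac{\widehat p_{i,j}^{(n)}}{\widehat p_{X,i}^{(n)}\,\widehat p_{Y,j}^{(n)}}$$ be the Shannon mutual information of $(X,Y)$ and its plug-in estimator (natural logarithm; a term with $\widehat p_{i,j}^{(n)}=0$ is $0$). With $B_{i,j}=\log\frac{p_{i,j}}{p_{X,i}\,p_{Y,j}}$ let $$\sigma^2=\sum_{i,j}p_{i,j}(1-p_{i,j})B_{i,j}^2-\sum_{(i,j)\neq(i',j')}p_{i,j}\,p_{i',j'}\,B_{i,j}B_{i',j'},$$ where the second sum runs over all ordered pairs of distinct cells. Then $\sigma^2\ge 0$ and, as $n\to\infty$, $$\widehat{\mathcal E}_n-\mathcal E\longrightarrow 0\ \text{ almost surely},\qquad \sqrt n\,(\widehat{\mathcal E}_n-\mathcal E)\longrightarrow\mathcal N(0,\sigma^2)\ \text{ in distribution},$$ where $\mathcal N(0,0)$ is the point mass at $0$. -/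

import Mathlib

open MeasureTheory ProbabilityTheory Filter Topology

noncomputable section

/-- The position of the cell `(i, j)` in the row-by-row enumeration of an `r × s` table. With
indices counted from `0` it is `s * i + j`, that is `s (i - 1) + j` with indices counted
from `1`. -/
def cellIndex {r s : ℕ} (i : Fin r) (j : Fin s) : Fin (r * s) :=
  finProdFinEquiv (i, j)

theorem cellIndex_val {r s : ℕ} (i : Fin r) (j : Fin s) :
    (cellIndex i j : ℕ) = s * i + j := by
  simp [cellIndex, finProdFinEquiv, Nat.add_comm]

/-- The probability mass function `k ↦ ℙ(W = w k)`. -/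
def pmfOf {Ω E ι : Type*} [MeasurableSpace Ω] (P : Measure Ω) (W : Ω → E) (w : ι → E) (k : ι) : ℝ :=
  P.real {ω | W ω = w k}

/-- The joint probability mass function `(i, j) ↦ ℙ(X = x i, Y = y j)`. -/
def jointPmf {Ω E F ι κ : Type*} [MeasurableSpace Ω] (P : Measure Ω) (X : Ω → E) (Y : Ω → F)
    (x : ι → E) (y : κ → F) (i : ι) (j : κ) : ℝ :=
  P.real {ω | X ω = x i ∧ Y ω = y j}

/-- The Shannon mutual information (natural logarithm) of a table `p` with marginals `pX`, `pY`.
A cell with `p i j = 0` contributes `0`, which is the usual convention `0 log 0 = 0`. -/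
def mutualInfo {r s : ℕ} (p : Fin r → Fin s → ℝ) (pX : Fin r → ℝ) (pY : Fin s → ℝ) : ℝ :=
  ∑ i, ∑ j, p i j * Real.log (p i j / (pX i * pY j))

/-- The relative frequency of the value `z k` in the sample consisting of the first `n` terms of
the sequence `ζ`. -/
def empFreq {E ι : Type*} (z : ι → E) (ζ : ℕ → E) (n : ℕ) (k : ι) : ℝ :=
  (1 / (n : ℝ)) * ∑ l ∈ Finset.range n, Set.indicator {z k} (fun _ => (1 : ℝ)) (ζ l)

/-- The estimated table of joint probabilities. -/
def empJoint {r s : ℕ} {E : Type*} (z : Fin (r * s) → E) (ζ : ℕ → E) (n : ℕ)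
    (i : Fin r) (j : Fin s) : ℝ :=
  empFreq z ζ n (cellIndex i j)

/-- The plug-in estimator of the mutual information; the marginals are estimated by the row sums
and the column sums of the estimated table. -/
def empMutualInfo {r s : ℕ} {E : Type*} (z : Fin (r * s) → E) (ζ : ℕ → E) (n : ℕ) : ℝ :=
  mutualInfo (empJoint z ζ n : Fin r → Fin s → ℝ)
    (fun i => ∑ j, empJoint z ζ n i j) (fun j => ∑ i, empJoint z ζ n i j)

/-- `B i j = log (p i j / (pX i * pY j))`. -/
def logRatio {r s : ℕ} (p : Fin r → Fin s → ℝ) (pX : Fin r → ℝ) (pY : Fin s → ℝ)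
    (i : Fin r) (j : Fin s) : ℝ :=
  Real.log (p i j / (pX i * pY j))

/-- The asymptotic variance: the sum of `p i j * (1 - p i j) * (B i j) ^ 2` over all cells, minus
the sum of `p i j * p i' j' * B i j * B i' j'` over all ordered pairs of distinct cells. -/
def asympVar {r s : ℕ} (p : Fin r → Fin s → ℝ) (pX : Fin r → ℝ) (pY : Fin s → ℝ) : ℝ :=
  (∑ c : Fin r × Fin s, p c.1 c.2 * (1 - p c.1 c.2) * logRatio p pX pY c.1 c.2 ^ 2)
    - ∑ d : (Fin r × Fin s) × (Fin r × Fin s) with d.1 ≠ d.2,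
        p d.1.1 d.1.2 * p d.2.1 d.2.2 *
          (logRatio p pX pY d.1.1 d.1.2 * logRatio p pX pY d.2.1 d.2.2)

end

/-! With `φ x = x * log x`, the mutual information of a table with its own marginals is the sum of
`φ` over cells minus the sums of `φ` over row sums and over column sums. The first-order Taylor
remainder of `φ` at `q > 0` is at most `(x - q) ^ 2 / q` for every `x ≥ 0`, zero included. Hence the
estimation error is a linear form in the cell deviations plus a remainder bounded globally by `C`
times the sum of their squares (`exists_abs_mutualInfo_sub_linear_le`), and no localisation near `p`
is needed.

The linear form has coefficients `B i j - 1`; it is a centred sample mean of i.i.d. bounded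
variables, to which the central limit theorem applies, and its variance is `asympVar` (hence
nonnegative). The squared deviations have expectation `O(1/n)`, so the remainder times `√n` tends to
`0` in `L¹`, and Slutsky's lemma concludes. Almost sure convergence follows from the strong law and
the continuity of `φ`. -/

/-! ### Quadratic expansion of the mutual information -/

theorem abs_mul_log_sub_taylor_le {x q : ℝ} (hx : 0 ≤ x) (hq : 0 < q) :
    |x * Real.log x - q * Real.log q - (Real.log q + 1) * (x - q)| ≤ (x - q) ^ 2 / q := by
  rcases hx.eq_or_lt with rfl | hx
  · have : (0 : ℝ) * Real.log 0 - q * Real.log q - (Real.log q + 1) * (0 - q) = q := by ring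
    rw [this, abs_of_pos hq]
    apply le_of_eq
    field_simp
    ring
  · have key : x * Real.log x - q * Real.log q - (Real.log q + 1) * (x - q)
        = x * Real.log (x / q) - x + q := by
      rw [Real.log_div hx.ne' hq.ne']; ring
    -- With `t = x / q`, the bounds `1 - 1/t ≤ log t ≤ t - 1` place the remainder between `0` and
    -- `(x - q) ^ 2 / q`.
    have hxq : 0 < x / q := div_pos hx hq
    have upper := mul_le_mul_of_nonneg_left (Real.log_le_sub_one_of_pos hxq) hx.le
    have lower := mul_le_mul_of_nonneg_left (Real.one_sub_inv_le_log_of_pos hxq) hx.le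
    have e₁ : x * (x / q - 1) - x + q = (x - q) ^ 2 / q := by field_simp; ring
    have e₂ : x * (1 - (x / q)⁻¹) - x + q = 0 := by field_simp; ring
    rw [key, abs_of_nonneg (by linarith)]
    linarith

/-- Empty cells are harmless: a zero cell contributes `0` to each sum, while a positive cell forces
its row and column sums to be positive, so its logarithm splits. -/
theorem mutualInfo_eq_sum_mul_log {r s : ℕ} {p : Fin r → Fin s → ℝ} (hp : ∀ i j, 0 ≤ p i j) :
    mutualInfo p (fun i => ∑ j, p i j) (fun j => ∑ i, p i j)
      = ∑ i, ∑ j, p i j * Real.log (p i j)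
        - ∑ i, (∑ j, p i j) * Real.log (∑ j, p i j)
        - ∑ j, (∑ i, p i j) * Real.log (∑ i, p i j) := by
  have hterm : ∀ i j, p i j * Real.log (p i j / ((∑ j', p i j') * ∑ i', p i' j))
      = p i j * Real.log (p i j) - p i j * Real.log (∑ j', p i j')
        - p i j * Real.log (∑ i', p i' j) := by
    intro i j
    rcases (hp i j).eq_or_lt with h | h
    · simp [← h]
    · have hr : 0 < ∑ j', p i j' :=
        Finset.sum_pos' (fun _ _ => hp _ _) ⟨j, Finset.mem_univ _, h⟩
      have hc : 0 < ∑ i', p i' j :=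
        Finset.sum_pos' (fun _ _ => hp _ _) ⟨i, Finset.mem_univ _, h⟩
      rw [Real.log_div h.ne' (mul_pos hr hc).ne', Real.log_mul hr.ne' hc.ne']
      ring
  unfold mutualInfo
  simp_rw [hterm, Finset.sum_sub_distrib]
  congr 1
  · simp_rw [Finset.sum_mul]
  · rw [Finset.sum_comm]
    simp_rw [Finset.sum_mul]

/-- First order expansion of the mutual information at a table with positive entries. -/
theorem exists_abs_mutualInfo_sub_linear_le {r s : ℕ} {p : Fin r → Fin s → ℝ}
    (hp : ∀ i j, 0 < p i j) :
    ∃ C : ℝ, ∀ q : Fin r → Fin s → ℝ, (∀ i j, 0 ≤ q i j) →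
      |mutualInfo q (fun i => ∑ j, q i j) (fun j => ∑ i, q i j)
          - mutualInfo p (fun i => ∑ j, p i j) (fun j => ∑ i, p i j)
          - ∑ i, ∑ j, (q i j - p i j) *
            (logRatio p (fun i => ∑ j, p i j) (fun j => ∑ i, p i j) i j - 1)|
        ≤ C * ∑ i, ∑ j, (q i j - p i j) ^ 2 := by
  -- The factors `s` and `r` come from Cauchy–Schwarz, which bounds the squared deviation of a row
  -- or column sum by the squared cell deviations.
  refine ⟨∑ i, ∑ j, 1 / p i j + ∑ i, s / (∑ j, p i j) + ∑ j, r / (∑ i, p i j), fun q hq => ?_⟩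
  set S := ∑ i, ∑ j, (q i j - p i j) ^ 2 with hS
  have hrow_le (i) : ∑ j, (q i j - p i j) ^ 2 ≤ S :=
    Finset.single_le_sum (f := fun i => ∑ j, (q i j - p i j) ^ 2)
      (fun _ _ => Finset.sum_nonneg fun _ _ => sq_nonneg _) (Finset.mem_univ i)
  have hcol_le (j) : ∑ i, (q i j - p i j) ^ 2 ≤ S := by
    rw [hS, Finset.sum_comm]
    exact Finset.single_le_sum (f := fun j => ∑ i, (q i j - p i j) ^ 2)
      (fun _ _ => Finset.sum_nonneg fun _ _ => sq_nonneg _) (Finset.mem_univ j)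
  have hcell_le (i j) : (q i j - p i j) ^ 2 ≤ S :=
    (Finset.single_le_sum (f := fun j => (q i j - p i j) ^ 2)
      (fun _ _ => sq_nonneg _) (Finset.mem_univ j)).trans (hrow_le i)
  let ψ : ℝ → ℝ → ℝ := fun x y =>
    x * Real.log x - y * Real.log y - (Real.log y + 1) * (x - y)
  have hcell (i j) : |ψ (q i j) (p i j)| ≤ 1 / p i j * S := by
    refine (abs_mul_log_sub_taylor_le (hq i j) (hp i j)).trans ?_
    rw [div_eq_mul_one_div, mul_comm]
    exact mul_le_mul_of_nonneg_left (hcell_le i j) (one_div_nonneg.2 (hp i j).le)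
  have hrow (i) : |ψ (∑ j, q i j) (∑ j, p i j)| ≤ s / (∑ j, p i j) * S := by
    rcases isEmpty_or_nonempty (Fin s) with h | h
    · simp [ψ]
    have h0 : 0 < ∑ j, p i j := Finset.sum_pos (fun _ _ => hp _ _) Finset.univ_nonempty
    refine (abs_mul_log_sub_taylor_le (Finset.sum_nonneg fun _ _ => hq _ _) h0).trans ?_
    rw [← Finset.sum_sub_distrib, div_mul_eq_mul_div]
    have := sq_sum_le_card_mul_sum_sq (s := (Finset.univ : Finset (Fin s)))
      (f := fun j => q i j - p i j)
    simp only [Finset.card_univ, Fintype.card_fin] at this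
    have := this.trans (mul_le_mul_of_nonneg_left (hrow_le i) (Nat.cast_nonneg s))
    gcongr
  have hcol (j) : |ψ (∑ i, q i j) (∑ i, p i j)| ≤ r / (∑ i, p i j) * S := by
    rcases isEmpty_or_nonempty (Fin r) with h | h
    · simp [ψ]
    have h0 : 0 < ∑ i, p i j := Finset.sum_pos (fun _ _ => hp _ _) Finset.univ_nonempty
    refine (abs_mul_log_sub_taylor_le (Finset.sum_nonneg fun _ _ => hq _ _) h0).trans ?_
    rw [← Finset.sum_sub_distrib, div_mul_eq_mul_div]
    have := sq_sum_le_card_mul_sum_sq (s := (Finset.univ : Finset (Fin r)))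
      (f := fun i => q i j - p i j)
    simp only [Finset.card_univ, Fintype.card_fin] at this
    have := this.trans (mul_le_mul_of_nonneg_left (hcol_le j) (Nat.cast_nonneg r))
    gcongr
  -- Each `φ` has derivative `log + 1`; one cell term minus two marginal terms leaves `B i j + 1 - 1
  -- - 1 = B i j - 1`.
  have hlin : ∑ i, ∑ j, (q i j - p i j) *
        (logRatio p (fun i => ∑ j, p i j) (fun j => ∑ i, p i j) i j - 1)
      = ∑ i, ∑ j, (Real.log (p i j) + 1) * (q i j - p i j)
        - ∑ i, (Real.log (∑ j, p i j) + 1) * (∑ j, q i j - ∑ j, p i j)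
        - ∑ j, (Real.log (∑ i, p i j) + 1) * (∑ i, q i j - ∑ i, p i j) := by
    have hterm (i j) : (q i j - p i j) *
          (logRatio p (fun i => ∑ j, p i j) (fun j => ∑ i, p i j) i j - 1)
        = (Real.log (p i j) + 1) * (q i j - p i j)
          - (Real.log (∑ j, p i j) + 1) * (q i j - p i j)
          - (Real.log (∑ i, p i j) + 1) * (q i j - p i j) := by
      have hr : 0 < ∑ j', p i j' :=
        Finset.sum_pos (fun _ _ => hp _ _) ⟨j, Finset.mem_univ _⟩
      have hc : 0 < ∑ i', p i' j :=
        Finset.sum_pos (fun _ _ => hp _ _) ⟨i, Finset.mem_univ _⟩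
      rw [logRatio, Real.log_div (hp i j).ne' (mul_pos hr hc).ne', Real.log_mul hr.ne' hc.ne']
      ring
    simp_rw [hterm, Finset.sum_sub_distrib, ← Finset.sum_sub_distrib, Finset.mul_sum]
    simp_rw [Finset.sum_sub_distrib]
    congr 1
    rw [Finset.sum_comm]
  have hsplit : mutualInfo q (fun i => ∑ j, q i j) (fun j => ∑ i, q i j)
        - mutualInfo p (fun i => ∑ j, p i j) (fun j => ∑ i, p i j)
        - ∑ i, ∑ j, (q i j - p i j) *
          (logRatio p (fun i => ∑ j, p i j) (fun j => ∑ i, p i j) i j - 1)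
      = ∑ i, ∑ j, ψ (q i j) (p i j) - ∑ i, ψ (∑ j, q i j) (∑ j, p i j)
        - ∑ j, ψ (∑ i, q i j) (∑ i, p i j) := by
    rw [hlin, mutualInfo_eq_sum_mul_log hq, mutualInfo_eq_sum_mul_log fun i j => (hp i j).le]
    simp only [ψ, Finset.sum_sub_distrib]
    ring
  rw [hsplit, add_mul, add_mul]
  refine (abs_sub _ _).trans (add_le_add ((abs_sub _ _).trans (add_le_add ?_ ?_)) ?_)
  · simp_rw [Finset.sum_mul]
    exact (Finset.abs_sum_le_sum_abs _ _).trans <| Finset.sum_le_sum fun i _ =>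
      (Finset.abs_sum_le_sum_abs _ _).trans <| Finset.sum_le_sum fun j _ => hcell i j
  · rw [Finset.sum_mul]
    exact (Finset.abs_sum_le_sum_abs _ _).trans <| Finset.sum_le_sum fun i _ => hrow i
  · rw [Finset.sum_mul]
    exact (Finset.abs_sum_le_sum_abs _ _).trans <| Finset.sum_le_sum fun j _ => hcol j

/-! ### Mean square error and convergence in measure -/

theorem integral_sq_sample_mean_sub {Ω : Type*} [MeasurableSpace Ω] {P : Measure Ω}
    [IsProbabilityMeasure P] {W : ℕ → Ω → ℝ} (hW : MemLp (W 0) 2 P)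
    (hindep : iIndepFun W P) (hident : ∀ l, IdentDistrib (W l) (W 0) P P) {n : ℕ} (hn : n ≠ 0) :
    ∫ ω, (1 / (n : ℝ) * ∑ l ∈ Finset.range n, W l ω - P[W 0]) ^ 2 ∂P = Var[W 0; P] / n := by
  have hL (l) : MemLp (W l) 2 P := (hident l).memLp_iff.2 hW
  have hn' : (n : ℝ) ≠ 0 := Nat.cast_ne_zero.2 hn
  have hmean : P[fun ω => 1 / (n : ℝ) * ∑ l ∈ Finset.range n, W l ω] = P[W 0] := by
    rw [integral_const_mul, integral_finsetSum _ fun l _ => (hL l).integrable one_le_two]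
    simp_rw [(hident _).integral_eq]
    simp [hn']
  have hvar : Var[fun ω => 1 / (n : ℝ) * ∑ l ∈ Finset.range n, W l ω; P] = Var[W 0; P] / n := by
    rw [variance_const_mul]
    have h := IndepFun.variance_sum (μ := P) (s := Finset.range n) (X := W) (fun l _ => hL l)
      fun i _ j _ hij => hindep.indepFun hij
    rw [Finset.sum_fn] at h
    simp_rw [h, (hident _).variance_eq]
    simp
    field_simp
  have hmeas : AEMeasurable (fun ω => 1 / (n : ℝ) * ∑ l ∈ Finset.range n, W l ω) P :=
    (Finset.aemeasurable_fun_sum _ fun l _ => (hL l).aestronglyMeasurable.aemeasurable).const_mul _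
  rw [← hvar, variance_eq_integral hmeas, hmean]

theorem tendstoInMeasure_zero_of_abs_le {Ω : Type*} [MeasurableSpace Ω] {P : Measure Ω}
    {R U : ℕ → Ω → ℝ} (hR : ∀ n, AEMeasurable (R n) P) (hU : ∀ n, Integrable (U n) P)
    (hRU : ∀ n ω, |R n ω| ≤ U n ω) (hlim : Tendsto (fun n => ∫ ω, U n ω ∂P) atTop (𝓝 0)) :
    TendstoInMeasure P R atTop 0 := by
  refine tendstoInMeasure_of_tendsto_eLpNorm one_ne_zero (fun n => (hR n).aestronglyMeasurable)
    aestronglyMeasurable_zero ?_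
  have hlim' := ENNReal.tendsto_ofReal hlim
  rw [ENNReal.ofReal_zero] at hlim'
  refine tendsto_of_tendsto_of_tendsto_of_le_of_le tendsto_const_nhds hlim'
    (fun _ => zero_le) fun n => ?_
  simp only [sub_zero, eLpNorm_one_eq_lintegral_enorm]
  rw [ofReal_integral_eq_lintegral_ofReal (hU n)
    (ae_of_all _ fun ω => (abs_nonneg _).trans (hRU n ω))]
  refine lintegral_mono fun ω => ?_
  rw [Real.enorm_eq_ofReal_abs]
  exact ENNReal.ofReal_le_ofReal (hRU n ω)

/-! ### Moments of functions of a discrete variable -/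

/-- The `z k` are distinct, so at most one indicator is nonzero at `g` and the cross terms vanish.
-/
theorem sum_indicator_singleton_mul_sq {G ι : Type*} [Fintype ι] {z : ι → G}
    (hz : Function.Injective z) (c : ι → ℝ) (g : G) :
    (∑ k, Set.indicator {z k} (fun _ => (1 : ℝ)) g * c k) ^ 2
      = ∑ k, Set.indicator {z k} (fun _ => (1 : ℝ)) g * c k ^ 2 := by
  by_cases hg : ∃ k, z k = g
  · obtain ⟨k, rfl⟩ := hg
    have (d : ι → ℝ) : ∑ j, Set.indicator {z j} (fun _ => (1 : ℝ)) (z k) * d j = d k := by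
      rw [Finset.sum_eq_single k]
      · simp
      · intro j _ hj
        simp [Set.indicator, hz.ne hj.symm]
      · simp
    rw [this, this fun j => c j ^ 2]
  · push Not at hg
    simp [Set.indicator, fun k => (hg k).symm]

section Indicator

variable {Ω G : Type*} [MeasurableSpace Ω] [MeasurableSpace G] [MeasurableSingletonClass G]

theorem measurable_indicator_singleton_one (a : G) :
    Measurable (Set.indicator {a} (fun _ => (1 : ℝ))) :=
  measurable_const.indicator (measurableSet_singleton a)

theorem memLp_indicator_singleton_comp {P : Measure Ω} [IsProbabilityMeasure P] {Z : Ω → G}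
    (hZ : AEMeasurable Z P) (a : G) :
    MemLp (fun ω => Set.indicator {a} (fun _ => (1 : ℝ)) (Z ω)) 2 P := by
  refine MemLp.of_bound
    ((measurable_indicator_singleton_one a).comp_aemeasurable hZ).aestronglyMeasurable 1
    (ae_of_all _ fun ω => ?_)
  by_cases h : Z ω = a <;> simp [h]

theorem integral_indicator_singleton_comp {ι : Type*} {P : Measure Ω} {Z : Ω → G}
    (hZ : Measurable Z) (z : ι → G) (k : ι) :
    ∫ ω, Set.indicator {z k} (fun _ => (1 : ℝ)) (Z ω) ∂P = pmfOf P Z z k := by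
  have : (fun ω => Set.indicator {z k} (fun _ => (1 : ℝ)) (Z ω))
      = Set.indicator {ω | Z ω = z k} 1 := by
    ext ω; by_cases h : Z ω = z k <;> simp [h]
  rw [this]
  exact integral_indicator_one (hZ (measurableSet_singleton (z k)))

variable {ι : Type*} [Fintype ι] {P : Measure Ω} [IsProbabilityMeasure P] {Z : Ω → G}

theorem integral_sum_indicator_singleton_mul (hZ : Measurable Z) (z : ι → G) (c : ι → ℝ) :
    ∫ ω, ∑ k, Set.indicator {z k} (fun _ => (1 : ℝ)) (Z ω) * c k ∂P
      = ∑ k, pmfOf P Z z k * c k := by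
  rw [integral_finsetSum _ fun k _ =>
    ((memLp_indicator_singleton_comp hZ.aemeasurable (z k)).integrable one_le_two).mul_const _]
  simp_rw [integral_mul_const, integral_indicator_singleton_comp hZ]

theorem memLp_sum_indicator_singleton_mul (hZ : AEMeasurable Z P) (z : ι → G) (c : ι → ℝ) :
    MemLp (fun ω => ∑ k, Set.indicator {z k} (fun _ => (1 : ℝ)) (Z ω) * c k) 2 P :=
  memLp_finsetSum _ fun k _ => (memLp_indicator_singleton_comp hZ (z k)).mul_const _

theorem variance_sum_indicator_singleton_mul (hZ : Measurable Z) {z : ι → G}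
    (hz : Function.Injective z) (c : ι → ℝ) :
    Var[fun ω => ∑ k, Set.indicator {z k} (fun _ => (1 : ℝ)) (Z ω) * c k; P]
      = ∑ k, pmfOf P Z z k * c k ^ 2 - (∑ k, pmfOf P Z z k * c k) ^ 2 := by
  rw [variance_eq_sub (memLp_sum_indicator_singleton_mul hZ.aemeasurable z c)]
  simp only [Pi.pow_apply, sum_indicator_singleton_mul_sq hz]
  rw [integral_sum_indicator_singleton_mul hZ, integral_sum_indicator_singleton_mul hZ]

theorem sum_pmfOf_eq_one (hZ : Measurable Z) {z : ι → G} (hz : Function.Injective z)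
    (hZz : ∀ᵐ ω ∂P, Z ω ∈ Set.range z) : ∑ k, pmfOf P Z z k = 1 := by
  have h := integral_sum_indicator_singleton_mul (P := P) hZ z fun _ => 1
  simp only [mul_one] at h
  rw [← h, integral_congr_ae (g := fun _ => (1 : ℝ)), integral_const]
  · simp
  filter_upwards [hZz] with ω ⟨k, hk⟩
  rw [← hk, Finset.sum_eq_single k]
  · simp
  · intro j _ hj
    simp [Set.indicator, hz.ne hj.symm]
  · simp

end Indicator

/-! ### Marginals, variance formula and continuity -/

theorem measureReal_eq_sum_inter_fiber {Ω F ι : Type*} [MeasurableSpace Ω] [Fintype ι]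
    [MeasurableSpace F] [MeasurableSingletonClass F] {P : Measure Ω} [IsFiniteMeasure P]
    {Y : Ω → F} (hY : Measurable Y) {y : ι → F} (hy : Function.Injective y)
    (hYy : ∀ᵐ ω ∂P, Y ω ∈ Set.range y) {A : Set Ω} (hA : MeasurableSet A) :
    P.real A = ∑ j, P.real (A ∩ {ω | Y ω = y j}) := by
  have hYm (j) : MeasurableSet {ω | Y ω = y j} := hY (measurableSet_singleton (y j))
  rw [← measureReal_iUnion_fintype _ fun j => hA.inter (hYm j)]
  · refine measureReal_congr ?_
    filter_upwards [hYy] with ω ⟨j, hj⟩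
    refine propext ⟨fun h => Set.mem_iUnion.2 ⟨j, h, hj.symm⟩, fun h => ?_⟩
    obtain ⟨_, h, _⟩ := Set.mem_iUnion.1 h
    exact h
  · intro i j hij
    refine Set.disjoint_left.2 fun ω hi hj => hij (hy ?_)
    exact hi.2.symm.trans hj.2

/-- The diagonal pairs missing from the double sum are the `-(p * B) ^ 2` parts of the first sum;
together they complete the square, giving the variance of `B`. -/
theorem asympVar_eq {r s : ℕ} (p : Fin r → Fin s → ℝ) (pX : Fin r → ℝ) (pY : Fin s → ℝ) :
    asympVar p pX pY = ∑ c : Fin r × Fin s, p c.1 c.2 * logRatio p pX pY c.1 c.2 ^ 2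
      - (∑ c : Fin r × Fin s, p c.1 c.2 * logRatio p pX pY c.1 c.2) ^ 2 := by
  set a : Fin r × Fin s → ℝ := fun c => p c.1 c.2 * logRatio p pX pY c.1 c.2 with ha
  have hall : (∑ c, a c) ^ 2 = ∑ d : (Fin r × Fin s) × (Fin r × Fin s), a d.1 * a d.2 := by
    rw [sq, Finset.sum_mul_sum, Fintype.sum_prod_type (f := fun d => a d.1 * a d.2)]
  have hdiag : ∑ d : (Fin r × Fin s) × (Fin r × Fin s) with ¬ d.1 ≠ d.2, a d.1 * a d.2
      = ∑ c, a c ^ 2 := by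
    simp only [not_not, Finset.sum_filter]
    rw [← Finset.univ_product_univ, Finset.sum_product]
    simp [sq]
  have hsplit := Finset.sum_filter_add_sum_filter_not
    (Finset.univ : Finset ((Fin r × Fin s) × (Fin r × Fin s))) (fun d => d.1 ≠ d.2)
    fun d => a d.1 * a d.2
  have hoff : ∑ d : (Fin r × Fin s) × (Fin r × Fin s) with d.1 ≠ d.2,
        p d.1.1 d.1.2 * p d.2.1 d.2.2 *
          (logRatio p pX pY d.1.1 d.1.2 * logRatio p pX pY d.2.1 d.2.2)
      = ∑ d : (Fin r × Fin s) × (Fin r × Fin s) with d.1 ≠ d.2, a d.1 * a d.2 :=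
    Finset.sum_congr rfl fun d _ => by simp only [ha]; ring
  have hfirst : ∑ c : Fin r × Fin s, p c.1 c.2 * (1 - p c.1 c.2) * logRatio p pX pY c.1 c.2 ^ 2
      = ∑ c : Fin r × Fin s, p c.1 c.2 * logRatio p pX pY c.1 c.2 ^ 2 - ∑ c, a c ^ 2 := by
    rw [← Finset.sum_sub_distrib]
    exact Finset.sum_congr rfl fun c _ => by simp only [ha]; ring
  rw [asympVar, hoff, hfirst, hall, ← hsplit, hdiag]
  ring

/-- `x * log x` is continuous on all of `ℝ`, so cells with limit `0` need no separate treatment. -/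
theorem tendsto_mutualInfo {r s : ℕ} {p : Fin r → Fin s → ℝ} {q : ℕ → Fin r → Fin s → ℝ}
    (hp : ∀ i j, 0 ≤ p i j) (hq : ∀ n i j, 0 ≤ q n i j)
    (hlim : ∀ i j, Tendsto (fun n => q n i j) atTop (𝓝 (p i j))) :
    Tendsto (fun n => mutualInfo (q n) (fun i => ∑ j, q n i j) (fun j => ∑ i, q n i j)) atTop
      (𝓝 (mutualInfo p (fun i => ∑ j, p i j) (fun j => ∑ i, p i j))) := by
  have hlog {u : ℕ → ℝ} {a : ℝ} (h : Tendsto u atTop (𝓝 a)) :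
      Tendsto (fun n => u n * Real.log (u n)) atTop (𝓝 (a * Real.log a)) :=
    (Real.continuous_mul_log.tendsto a).comp h
  rw [mutualInfo_eq_sum_mul_log hp]
  simp_rw [mutualInfo_eq_sum_mul_log (hq _)]
  refine ((tendsto_finsetSum _ fun i _ => tendsto_finsetSum _ fun j _ => hlog (hlim i j)).sub
    (tendsto_finsetSum _ fun i _ => hlog (tendsto_finsetSum _ fun j _ => hlim i j))).sub
    (tendsto_finsetSum _ fun j _ => hlog (tendsto_finsetSum _ fun i _ => hlim i j))

/-! ### The limit theorems -/

theorem theorem2 {Ω Ω' E F G : Type*} [MeasurableSpace Ω] [MeasurableSpace Ω']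
    [MeasurableSpace E] [MeasurableSingletonClass E]
    [MeasurableSpace F] [MeasurableSingletonClass F]
    [MeasurableSpace G] [MeasurableSingletonClass G]
    (P : Measure Ω) [IsProbabilityMeasure P] (P' : Measure Ω') [IsProbabilityMeasure P']
    {r s : ℕ} (x : Fin r → E) (y : Fin s → F) (z : Fin (r * s) → G)
    (hx : Function.Injective x) (hy : Function.Injective y) (hz : Function.Injective z)
    -- the pair `(X, Y)`
    (X : Ω → E) (Y : Ω → F) (hX : Measurable X) (hY : Measurable Y)
    (hXx : ∀ᵐ ω ∂P, X ω ∈ Set.range x) (hYy : ∀ᵐ ω ∂P, Y ω ∈ Set.range y)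
    -- the single random variable `Z` associated with the pair
    (Z : Ω → G) (hZ : Measurable Z) (hZz : ∀ᵐ ω ∂P, Z ω ∈ Set.range z)
    (hXYZ : ∀ i j, jointPmf P X Y x y i j = pmfOf P Z z (cellIndex i j))
    -- every cell has positive probability
    (hpos : ∀ k, 0 < pmfOf P Z z k)
    -- the sample: independent copies of `Z`
    (ζ : ℕ → Ω' → G) (hindep : iIndepFun ζ P') (hident : ∀ l, IdentDistrib (ζ l) Z P' P) :
    (∀ᵐ ω ∂P', Tendsto
      (fun n : ℕ => empMutualInfo (r := r) (s := s) z (fun l => ζ l ω) n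
        - mutualInfo (jointPmf P X Y x y) (pmfOf P X x) (pmfOf P Y y))
      atTop (𝓝 0)) ∧
    0 ≤ asympVar (jointPmf P X Y x y) (pmfOf P X x) (pmfOf P Y y) ∧
    TendstoInDistribution
      (fun (n : ℕ) (ω : Ω') => Real.sqrt (n : ℝ) *
        (empMutualInfo (r := r) (s := s) z (fun l => ζ l ω) n
          - mutualInfo (jointPmf P X Y x y) (pmfOf P X x) (pmfOf P Y y)))
      atTop (id : ℝ → ℝ) (fun _ => P')
      (gaussianReal 0
        (asympVar (jointPmf P X Y x y) (pmfOf P X x) (pmfOf P Y y)).toNNReal) := by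
  have hk (i : Fin r) (j : Fin s) : cellIndex i j = finProdFinEquiv (i, j) := rfl
  set p := jointPmf P X Y x y
  have hXm (i) : MeasurableSet {ω | X ω = x i} := hX (measurableSet_singleton (x i))
  have hYm (j) : MeasurableSet {ω | Y ω = y j} := hY (measurableSet_singleton (y j))
  have hrow : pmfOf P X x = fun i => ∑ j, p i j :=
    funext fun i => measureReal_eq_sum_inter_fiber hY hy hYy (hXm i)
  have hcol : pmfOf P Y y = fun j => ∑ i, p i j := by
    funext j
    refine (measureReal_eq_sum_inter_fiber hX hx hXx (hYm j)).trans ?_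
    refine Finset.sum_congr rfl fun i _ => ?_
    rw [Set.inter_comm]
    rfl
  rw [hrow, hcol]
  have hp (i j) : 0 < p i j := hXYZ i j ▸ hpos _
  have hsum : ∑ c : Fin r × Fin s, p c.1 c.2 = 1 := by
    rw [← sum_pmfOf_eq_one hZ hz hZz, ← finProdFinEquiv.sum_comp]
    exact Finset.sum_congr rfl fun c _ => hXYZ c.1 c.2
  set B := logRatio p (fun i => ∑ j, p i j) (fun j => ∑ i, p i j) with hB
  let c : Fin (r * s) → ℝ := fun k =>
    B (finProdFinEquiv.symm k).1 (finProdFinEquiv.symm k).2 - 1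
  have hc (i j) : c (cellIndex i j) = B i j - 1 := by
    simp only [c, cellIndex, Equiv.symm_apply_apply]
  let b : G → ℝ := fun g => ∑ k, Set.indicator {z k} (fun _ => (1 : ℝ)) g * c k
  have hb : Measurable b := Finset.measurable_fun_sum _ fun k _ =>
    (measurable_indicator_singleton_one (z k)).mul_const _
  -- The shift by `-1` in `c` does not change the variance, because the cell probabilities sum to
  -- `1`.
  have hvar : Var[fun ω => b (Z ω); P]
      = asympVar p (fun i => ∑ j, p i j) (fun j => ∑ i, p i j) := by
    rw [variance_sum_indicator_singleton_mul hZ hz, asympVar_eq, ← finProdFinEquiv.sum_comp,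
      ← finProdFinEquiv.sum_comp, ← hB]
    have h₁ : ∑ d : Fin r × Fin s, pmfOf P Z z (finProdFinEquiv d) * c (finProdFinEquiv d)
        = ∑ d : Fin r × Fin s, p d.1 d.2 * B d.1 d.2 - 1 := by
      rw [← hsum, ← Finset.sum_sub_distrib]
      refine Finset.sum_congr rfl fun d _ => ?_
      rw [← hk d.1 d.2, hc, ← hXYZ]
      ring
    have h₂ : ∑ d : Fin r × Fin s, pmfOf P Z z (finProdFinEquiv d) * c (finProdFinEquiv d) ^ 2
        = ∑ d : Fin r × Fin s, p d.1 d.2 * B d.1 d.2 ^ 2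
          - 2 * ∑ d : Fin r × Fin s, p d.1 d.2 * B d.1 d.2 + 1 := by
      rw [← hsum, Finset.mul_sum, ← Finset.sum_sub_distrib, ← Finset.sum_add_distrib]
      refine Finset.sum_congr rfl fun d _ => ?_
      rw [← hk d.1 d.2, hc, ← hXYZ]
      ring
    rw [h₁, h₂]
    ring
  have hζ (l) : AEMeasurable (ζ l) P' := (hident l).aemeasurable_fst
  have hident₀ (l) : IdentDistrib (ζ l) (ζ 0) P' P' := (hident l).trans (hident 0).symm
  let W : Fin (r * s) → ℕ → Ω' → ℝ := fun k l ω =>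
    Set.indicator {z k} (fun _ => (1 : ℝ)) (ζ l ω)
  have hWLp (k l) : MemLp (W k l) 2 P' := memLp_indicator_singleton_comp (hζ l) (z k)
  have hWindep (k) : iIndepFun (W k) P' :=
    hindep.comp (fun _ => Set.indicator {z k} (fun _ => (1 : ℝ)))
      fun _ => measurable_indicator_singleton_one (z k)
  have hWident (k l) : IdentDistrib (W k l) (W k 0) P' P' :=
    (hident₀ l).comp (measurable_indicator_singleton_one (z k))
  have hWmean (k) : P'[W k 0] = pmfOf P Z z k := by
    rw [← integral_indicator_singleton_comp hZ z k]
    exact ((hident 0).comp (measurable_indicator_singleton_one (z k))).integral_eq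
  have hemp (n ω k) : empFreq z (fun l => ζ l ω) n k
      = 1 / (n : ℝ) * ∑ l ∈ Finset.range n, W k l ω := rfl
  have hemp_nonneg (n ω i j) : 0 ≤ (empJoint z (fun l => ζ l ω) n : Fin r → Fin s → ℝ) i j :=
    mul_nonneg (by positivity) (Finset.sum_nonneg fun l _ =>
      Set.indicator_nonneg (fun _ _ => zero_le_one) _)
  have hemp_meas (n k) : AEMeasurable (fun ω => empFreq z (fun l => ζ l ω) n k) P' :=
    (Finset.aemeasurable_fun_sum _ fun l _ =>
      (hWLp k l).aestronglyMeasurable.aemeasurable).const_mul _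
  have hjoint_meas (n) (i : Fin r) (j : Fin s) :
      AEMeasurable (fun ω => empJoint z (fun l => ζ l ω) n i j) P' := hemp_meas n _
  have hmi_meas (n) : AEMeasurable
      (fun ω => empMutualInfo (r := r) (s := s) z (fun l => ζ l ω) n) P' := by
    unfold empMutualInfo mutualInfo
    fun_prop
  refine ⟨?_, hvar ▸ variance_nonneg _ _, ?_⟩
  · have hlln : ∀ᵐ ω ∂P', ∀ k, Tendsto (fun n => empFreq z (fun l => ζ l ω) n k) atTop
        (𝓝 (pmfOf P Z z k)) := by
      refine ae_all_iff.2 fun k => ?_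
      filter_upwards [strong_law_ae_real (W k) ((hWLp k 0).integrable one_le_two)
        (fun _ _ h => (hWindep k).indepFun h) (hWident k)] with ω hω
      rw [hWmean k] at hω
      refine hω.congr fun n => ?_
      rw [hemp]
      ring
    filter_upwards [hlln] with ω hω
    have hω' (i j) : Tendsto (fun n => empJoint z (fun l => ζ l ω) n i j) atTop (𝓝 (p i j)) := by
      rw [hXYZ]
      exact hω _
    exact tendsto_sub_nhds_zero_iff.2 (tendsto_mutualInfo (fun i j => (hp i j).le)
      (fun n => hemp_nonneg n ω) hω')
  · obtain ⟨C, hC⟩ := exists_abs_mutualInfo_sub_linear_le hp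
    rw [← hvar]
    have hbident (l) : IdentDistrib (fun ω => b (ζ l ω)) (fun ω => b (Z ω)) P' P :=
      (hident l).comp hb
    have hclt := tendstoInDistribution_inv_sqrt_mul_sum_sub (P := P')
      (P' := gaussianReal 0 (Var[fun ω => b (Z ω); P]).toNNReal) (Y := id)
      (X := fun l ω => b (ζ l ω)) (by rw [(hbident 0).variance_eq]; exact HasLaw.id)
      (memLp_sum_indicator_singleton_mul (hζ 0) z c)
      (hindep.comp (fun _ => b) fun _ => hb) (fun l => (hident₀ l).comp hb)
    have hbmean : P'[fun ω => b (ζ 0 ω)] = ∑ i, ∑ j, p i j * (B i j - 1) := by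
      rw [(hbident 0).integral_eq, integral_sum_indicator_singleton_mul hZ,
        ← finProdFinEquiv.sum_comp, Fintype.sum_prod_type]
      simp_rw [← hk, hc, ← hXYZ]
    have hbsum (n : ℕ) (hn : n ≠ 0) (ω) : ∑ l ∈ Finset.range n, b (ζ l ω)
        = n * ∑ i, ∑ j, empJoint z (fun l => ζ l ω) n i j * (B i j - 1) := by
      have hn' : (n : ℝ) ≠ 0 := Nat.cast_ne_zero.2 hn
      rw [Finset.sum_comm, ← finProdFinEquiv.sum_comp, Fintype.sum_prod_type, Finset.mul_sum]
      refine Finset.sum_congr rfl fun i _ => ?_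
      rw [Finset.mul_sum]
      refine Finset.sum_congr rfl fun j _ => ?_
      rw [← Finset.sum_mul, ← hk, hc, empJoint, empFreq]
      field_simp
    have hmeas (n : ℕ) : AEMeasurable (fun ω => √(n : ℝ) *
        (empMutualInfo (r := r) (s := s) z (fun l => ζ l ω) n
          - mutualInfo p (fun i => ∑ j, p i j) (fun j => ∑ i, p i j))) P' :=
      ((hmi_meas n).sub_const _).const_mul _
    -- Slutsky: only the difference from the normalised sum of the `b (ζ l)` remains, and the
    -- quadratic bound dominates it.
    refine tendstoInDistribution_of_tendstoInMeasure_sub _ _ hclt ?_ hmeas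
    refine tendstoInMeasure_zero_of_abs_le
      (U := fun n ω => √(n : ℝ) * (C * ∑ i, ∑ j,
        (empJoint z (fun l => ζ l ω) n i j - p i j) ^ 2))
      (fun n => (hmeas n).sub (hclt.forall_aemeasurable n)) (fun n => ?_) (fun n ω => ?_) ?_
    · refine Integrable.const_mul (Integrable.const_mul ?_ _) _
      refine integrable_finsetSum _ fun i _ => integrable_finsetSum _ fun j _ => ?_
      refine MemLp.integrable_sq (MemLp.sub ?_ (memLp_const _))
      exact (memLp_finsetSum _ fun l _ => hWLp _ l).const_mul _
    · rcases eq_or_ne n 0 with rfl | hn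
      · simp
      have hn' : √(n : ℝ) ≠ 0 := by positivity
      have hsq : (√(n : ℝ))⁻¹ * n = √(n : ℝ) := by
        field_simp
        exact (Real.sq_sqrt (Nat.cast_nonneg n)).symm
      have hlin : (√(n : ℝ))⁻¹ * (∑ l ∈ Finset.range n, b (ζ l ω)
            - n * P'[fun ω => b (ζ 0 ω)])
          = √(n : ℝ) * ∑ i, ∑ j,
            (empJoint z (fun l => ζ l ω) n i j - p i j) * (B i j - 1) := by
        rw [hbsum n hn, hbmean, ← mul_sub, ← mul_assoc, hsq]
        simp_rw [sub_mul, Finset.sum_sub_distrib]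
      simp only [Pi.sub_apply]
      rw [hlin, ← mul_sub, abs_mul, abs_of_nonneg (Real.sqrt_nonneg _)]
      exact mul_le_mul_of_nonneg_left (hC _ (hemp_nonneg n ω)) (Real.sqrt_nonneg _)
    -- Each mean square error is a variance over `n`, so the factor `√n` leaves a constant times `1
    -- / √n`; at `n = 0` both sides vanish since `0⁻¹ = 0`.
    · have hint (n : ℕ) : ∫ ω, √(n : ℝ) * (C * ∑ i : Fin r, ∑ j : Fin s,
            (empJoint z (fun l => ζ l ω) n i j - p i j) ^ 2) ∂P'
          = C * (∑ i : Fin r, ∑ j : Fin s, Var[W (cellIndex i j) 0; P']) * (√(n : ℝ))⁻¹ := by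
        rcases eq_or_ne n 0 with rfl | hn
        · simp
        have hterm (i : Fin r) (j : Fin s) : MemLp (fun ω =>
            empJoint z (fun l => ζ l ω) n i j - p i j) 2 P' :=
          MemLp.sub ((memLp_finsetSum _ fun l _ => hWLp _ l).const_mul _) (memLp_const _)
        have hcell (i : Fin r) (j : Fin s) :
            ∫ ω, (empJoint z (fun l => ζ l ω) n i j - p i j) ^ 2 ∂P'
              = Var[W (cellIndex i j) 0; P'] / n := by
          rw [hXYZ, ← hWmean]
          exact integral_sq_sample_mean_sub (hWLp _ 0) (hWindep _) (hWident _) hn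
        rw [integral_const_mul, integral_const_mul, integral_finsetSum _ fun i _ =>
          integrable_finsetSum _ fun j _ => (hterm i j).integrable_sq]
        simp_rw [integral_finsetSum Finset.univ fun j _ => (hterm _ j).integrable_sq, hcell,
          ← Finset.sum_div]
        have hn' : √(n : ℝ) ≠ 0 := by positivity
        have hn₀ : (n : ℝ) = √(n : ℝ) ^ 2 := (Real.sq_sqrt (Nat.cast_nonneg n)).symm
        nth_rewrite 2 [hn₀]
        field_simp
      simp_rw [hint]
      have h₀ : Tendsto (fun n : ℕ => (√(n : ℝ))⁻¹) atTop (𝓝 0) :=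
        tendsto_inv_atTop_zero.comp (Real.tendsto_sqrt_atTop.comp tendsto_natCast_atTop_atTop)
      simpa using h₀.const_mul (C * ∑ i : Fin r, ∑ j : Fin s, Var[W (cellIndex i j) 0; P'])
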